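/- Let $n\ge 3$. An \emph{open conformal surface} is a connected noncompact surface (Hausdorff, second countable, without boundary, orientable or not) with an atlas of charts into $\mathbb C$ whose transition maps are conformal diffeomorphisms between open sets of $\mathbb C$ (possibly orientation reversing). A compact set $K$ in such a surface $M$ is \emph{Runge} if no connected component of $M\setminus K$ is relatively compact in $M$. An immersion into $\mathbb R^n$ that is conformal is called a conformal minimal immersion if it is harmonic (in local conformal coordinates); thus "conformal minimal immersion" and "conformal harmonic immersion" mean the same. Two smooth maps \emph{agree to order} $m$ at a point if their $m$-jets at that point (the values and all partial derivatives of order $\le m$ in local charts) coincide. A nonempty connected open set $\Omega\subset\mathbb R^n$ is a \emph{flexible domain} if for every open conformal surface $M$, compact Runge set $K\subset M$, finite set $A\subset K$, open neighbourhood $U$ of $K$, conformal harmonic immersion $f:U\to\Omega$, $\epsilon>0$ and $m\in\mathbb N$ there is a conformal harmonic immersion $\tilde f:M\to\Omega$ which agrees with $f$ to order $m$ at every point of $A$ and satisfies $|\tilde f(p)-f(p)|<\epsilon$ for all $p\in K$. **Proposition.** Let $\Omega\subset\mathbb R^n$ be a flexible domain. Let $M$ be an open conformal surface, $U\subset M$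 an open set, $K\subset U$ a compact set which is Runge in $M$, $A\subset U$ a (possibly finite or empty) closed discrete subset of $M$, and $f:U\to\Omega$ a conformal harmonic immersion. Then for every $\epsilon>0$ and every choice of integers $m_a\ge 0$ $(a\in A)$ there is a conformal minimal immersion $\tilde f:M\to\Omega$ which agrees with $f$ to order $m_a$ at $a$ for every $a\in A$ and satisfies $|f(p)-\tilde f(p)|<\epsilon$ for all $p\in K$. -/

import Mathlib

open scoped Manifold ContDiff

universe u

namespace MinimalSurface

section Surface

variable {M : Type u} [TopologicalSpace M]

/-- A compact set `K` in a surface `M` is Runge if no connected component of `M \ K` is relatively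
compact in `M`. -/
def IsCompactRunge (K : Set M) : Prop :=
  IsCompact K ∧ ∀ x ∈ Kᶜ, ¬ IsCompact (closure (connectedComponentIn Kᶜ x))

variable [ChartedSpace ℂ M] {n : ℕ}

/-- `f : M → ℝⁿ` is a conformal harmonic (equivalently, conformal minimal) immersion on the
set `U`: read in any local chart of the conformal surface `M`, it is harmonic at every point of `U`
and its differential there is conformal, that is, a nonzero multiple of a linear isometric
embedding of the plane (so it is injective). Only the values of `f` near `U` matter. -/
def IsConformalHarmonicImmersionOn (f : M → EuclideanSpace ℝ (Fin n)) (U : Set M) : Prop :=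
  ∀ φ ∈ atlas ℂ M, ∀ x ∈ U ∩ φ.source,
    InnerProductSpace.HarmonicAt (f ∘ φ.symm) (φ x) ∧ ConformalAt (f ∘ φ.symm) (φ x)

/-- `f` and `g` agree to order `m` at `p`: in any local chart at `p` their partial derivatives of
all orders `≤ m` coincide at `p` (their `m`-jets at `p` are equal). -/
def AgreeToOrder (m : ℕ) (f g : M → EuclideanSpace ℝ (Fin n)) (p : M) : Prop :=
  ∀ φ ∈ atlas ℂ M, p ∈ φ.source → ∀ j ≤ m,
    iteratedFDeriv ℝ j (f ∘ φ.symm) (φ p) = iteratedFDeriv ℝ j (g ∘ φ.symm) (φ p)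

end Surface

/-- A flexible domain in `ℝⁿ` (meant for `n ≥ 3`). The surfaces `M` are the open conformal surfaces:
connected, noncompact, Hausdorff and second countable, with an atlas of complex-valued charts
(orientable or not) whose transition maps are conformal diffeomorphisms between open sets of `ℂ`,
possibly reversing the orientation. -/
def IsFlexibleDomain {n : ℕ} (Ω : Set (EuclideanSpace ℝ (Fin n))) : Prop :=
  IsOpen Ω ∧ IsConnected Ω ∧
    ∀ (M : Type u) [TopologicalSpace M] [T2Space M] [SecondCountableTopology M]
      [ConnectedSpace M] [NoncompactSpace M] [ChartedSpace ℂ M]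
      [IsManifold 𝓘(ℝ, ℂ) ∞ M] [HasGroupoid M (conformalGroupoid (X := ℂ))]
      (K : Set M) (_ : IsCompactRunge K)
      (A : Set M) (_ : A.Finite) (_ : A ⊆ K)
      (U : Set M) (_ : IsOpen U) (_ : K ⊆ U)
      (f : M → EuclideanSpace ℝ (Fin n)) (_ : Set.MapsTo f U Ω)
      (_ : IsConformalHarmonicImmersionOn f U)
      (ε : ℝ) (_ : 0 < ε) (m : ℕ),
      ∃ g : M → EuclideanSpace ℝ (Fin n),
        (∀ p, g p ∈ Ω) ∧ IsConformalHarmonicImmersionOn g Set.univ ∧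
        (∀ a ∈ A, AgreeToOrder m g f a) ∧ ∀ p ∈ K, ‖g p - f p‖ < ε

end MinimalSurface

/-! Flexibility gives approximation on one compact Runge set with interpolation of a single order at
finitely many points of that set. Two devices extend this to all of `A`.

New interpolation points: let `g` be defined near a compact Runge set `K`, and let `F` be the finite
set of points of `A` in a larger compact set but not in `K`. Since punctured discs are connected, `K
∪ F` is again Runge. The map equal to `g` near `K` and to `f` near `F` satisfies the hypotheses of
flexibility, so `g` can be approximated on `K` while the jets of `f` are matched at the new points
as well (`IsFlexibleDomain.exists_approx`).

Passage to the limit: iterate along an exhaustion by compact Runge sets starting at `K`, with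
rapidly decreasing errors. Borel–Carathéodory and Cauchy estimates turn uniform convergence of
harmonic maps into convergence of all derivatives, so harmonicity, jets and the conformality
equations survive. Staying in `Ω` and having nonzero differential are stable under small
perturbation over a compact set. Each error is chosen so small that the total of all later
corrections cannot destroy these two properties. -/

namespace MinimalSurface

open Metric Filter Topology InnerProductSpace

/-! ### Harmonic maps on discs: interior estimates and uniform limits. -/

section Harmonic

/-- Borel–Carathéodory for a function that is real at the centre of the disc. -/
lemma norm_le_of_abs_re_le {F : ℂ → ℂ} {z : ℂ} {R B : ℝ} (hR : 0 < R) (hB : 0 < B)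
    (hF : DifferentiableOn ℂ F (ball z R)) (hre : ∀ w ∈ ball z R, |(F w).re| ≤ B)
    (him : (F z).im = 0) : ∀ w ∈ ball z (R / 2), ‖F w‖ ≤ 5 * B := by
  intro w hw
  have hz : ‖F z‖ ≤ B := by
    have h : F z = ((F z).re : ℂ) := Complex.ext (by simp) (by simp [him])
    rw [h, Complex.norm_real]
    exact hre z (mem_ball_self hR)
  have hmaps : ∀ v ∈ ball (0 : ℂ) R, z + v ∈ ball z R := fun v hv ↦ by simpa using hv
  have hG : DifferentiableOn ℂ (fun v ↦ F (z + v)) (ball 0 R) :=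
    hF.comp (by fun_prop) hmaps
  have hv : ‖w - z‖ < R / 2 := by simpa [dist_eq_norm] using hw
  have key := Complex.borelCaratheodory (z := w - z) hB hG
    (fun v hv ↦ (le_abs_self _).trans (hre _ (hmaps v hv))) hR (by simp; linarith)
  simp only [add_sub_cancel, add_zero] at key
  have hpos : 0 < R - ‖w - z‖ := by linarith
  -- The two terms of the Borel–Carathéodory bound, with `‖w - z‖ < R / 2`, contribute `2 * B` and
  -- `3 * B`.
  have h1 : 2 * B * ‖w - z‖ / (R - ‖w - z‖) ≤ 2 * B := by
    rw [div_le_iff₀ hpos]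
    nlinarith
  have h2 : ‖F z‖ * (R + ‖w - z‖) / (R - ‖w - z‖) ≤ 3 * B := by
    rw [div_le_iff₀ hpos]
    nlinarith [mul_le_mul_of_nonneg_right hz (by positivity : 0 ≤ R + ‖w - z‖)]
  linarith

/-- A harmonic function on a disc is the real part of a holomorphic function that is real at the
centre. -/
lemma exists_differentiableOn_re_eq {u : ℂ → ℝ} {z : ℂ} {R : ℝ}
    (hu : HarmonicOnNhd u (ball z R)) :
    ∃ F : ℂ → ℂ, DifferentiableOn ℂ F (ball z R) ∧ (∀ w ∈ ball z R, (F w).re = u w) ∧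
      (F z).im = 0 := by
  obtain ⟨F, hF, hre⟩ := hu.exists_analyticOnNhd_ball_re_eq
  refine ⟨fun w ↦ F w - Complex.I * (F z).im, ?_, fun w hw ↦ ?_, by simp⟩
  · exact hF.differentiableOn.sub_const _
  · simpa using hre hw

/-- The real derivatives of `F` are its complex ones with scalars restricted, and the complex `j`-th
derivative is multiplication of the product of the arguments by one number. -/
lemma norm_iteratedFDeriv_le_norm_iteratedDeriv {F : ℂ → ℂ} {z : ℂ} (hF : AnalyticAt ℂ F z)
    (j : ℕ) : ‖iteratedFDeriv ℝ j (fun w ↦ (F w).re) z‖ ≤ ‖iteratedDeriv j F z‖ := by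
  have h1 : ContDiffAt ℂ j F z := hF.contDiffAt
  have h2 : ContDiffAt ℝ j F z := h1.restrict_scalars ℝ
  have h3 : iteratedFDeriv ℝ j (fun w ↦ (F w).re) z =
      Complex.reCLM.compContinuousMultilinearMap (iteratedFDeriv ℝ j F z) :=
    Complex.reCLM.iteratedFDeriv_comp_left h2 le_rfl
  rw [h3, ← h1.restrictScalars_iteratedFDeriv]
  refine ContinuousMultilinearMap.opNorm_le_bound (norm_nonneg _) fun v ↦ ?_
  refine (Complex.abs_re_le_norm _).trans ?_
  have := iteratedFDeriv_apply_eq_iteratedDeriv_mul_prod (𝕜 := ℂ) (f := F) (x := z) (m := v)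
  change ‖iteratedFDeriv ℂ j F z v‖ ≤ _
  rw [this, norm_smul, norm_prod, mul_comm]

/-- Interior estimates for the derivatives of real harmonic functions on a disc. -/
lemma exists_norm_iteratedFDeriv_le_real (j : ℕ) {R : ℝ} (hR : 0 < R) :
    ∃ C : ℝ, 0 < C ∧ ∀ (u : ℂ → ℝ) (z : ℂ) (B : ℝ), 0 < B → HarmonicOnNhd u (ball z R) →
      (∀ w ∈ ball z R, |u w| ≤ B) → ‖iteratedFDeriv ℝ j u z‖ ≤ C * B := by
  -- Cauchy's estimate on the circle of radius `R / 4`, inside the half disc where the holomorphic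
  -- function is bounded by `5 * B`.
  refine ⟨j.factorial * 5 / (R / 4) ^ j, by positivity, fun u z B hB hu hb ↦ ?_⟩
  obtain ⟨F, hF, hre, him⟩ := exists_differentiableOn_re_eq hu
  have hb' := norm_le_of_abs_re_le hR hB hF (fun w hw ↦ by rw [hre w hw]; exact hb w hw) him
  have hcl : closure (ball z (R / 4)) ⊆ ball z (R / 2) :=
    closure_ball_subset_closedBall.trans (closedBall_subset_ball (by linarith))
  have hd : DiffContOnCl ℂ F (ball z (R / 4)) :=
    (hF.mono (hcl.trans (ball_subset_ball (by linarith)))).diffContOnCl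
  have hest := Complex.norm_iteratedDeriv_le_of_forall_mem_sphere_norm_le j (by linarith) hd
    (fun w hw ↦ hb' w (sphere_subset_closedBall.trans (closedBall_subset_ball (by linarith)) hw))
  have hev : u =ᶠ[𝓝 z] fun w ↦ (F w).re := by
    filter_upwards [ball_mem_nhds z hR] with w hw using (hre w hw).symm
  rw [(hev.iteratedFDeriv ℝ j).eq_of_nhds]
  refine (norm_iteratedFDeriv_le_norm_iteratedDeriv
    (hF.analyticAt (ball_mem_nhds z hR)) j).trans (hest.trans (le_of_eq ?_))
  ring

/-- A uniform limit of real harmonic functions is harmonic. -/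
lemma harmonicAt_of_tendstoUniformlyOn_real {u : ℕ → ℂ → ℝ} {v : ℂ → ℝ} {z : ℂ} {R : ℝ}
    (hR : 0 < R) (hu : ∀ᶠ k in atTop, HarmonicOnNhd (u k) (ball z R))
    (hlim : TendstoUniformlyOn u v atTop (ball z R)) : HarmonicAt v z := by
  obtain ⟨N, hN⟩ := eventually_atTop.1 hu
  choose F hF hre him using fun k ↦ exists_differentiableOn_re_eq (hN (k + N) (by omega))
  have hlim' : TendstoUniformlyOn (fun k ↦ u (k + N)) v atTop (ball z R) := fun s hs ↦
    (tendsto_add_atTop_nat N).eventually (hlim s hs)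
  -- Harmonic conjugates are determined only up to constants; normalising them to vanish at the
  -- centre lets the bound by the real part apply to `F k - F l`.
  have hc : UniformCauchySeqOn F atTop (ball z (R / 2)) := by
    rw [Metric.uniformCauchySeqOn_iff]
    intro ε hε
    obtain ⟨K, hK⟩ := Metric.uniformCauchySeqOn_iff.1 hlim'.uniformCauchySeqOn (ε / 10)
      (by positivity)
    refine ⟨K, fun k hk l hl w hw ↦ ?_⟩
    rw [dist_eq_norm]
    refine (norm_le_of_abs_re_le (F := fun w ↦ F k w - F l w) (B := ε / 10) hR (by positivity)
      ((hF k).sub (hF l)) (fun x hx ↦ ?_) (by simp [him]) w hw).trans_lt (by linarith)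
    have := hK k hk l hl x hx
    rw [Real.dist_eq] at this
    simpa [hre _ x hx] using this.le
  have hpt : ∀ w, ∃ y, w ∈ ball z (R / 2) → Tendsto (fun k ↦ F k w) atTop (𝓝 y) := by
    intro w
    by_cases hw : w ∈ ball z (R / 2)
    · obtain ⟨y, hy⟩ := cauchySeq_tendsto_of_complete (hc.cauchySeq hw)
      exact ⟨y, fun _ ↦ hy⟩
    · exact ⟨0, fun h ↦ absurd h hw⟩
  choose G hG using hpt
  have hu' : TendstoUniformlyOn F G atTop (ball z (R / 2)) :=
    hc.tendstoUniformlyOn_of_tendsto fun w hw ↦ hG w hw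
  have hsub : ball z (R / 2) ⊆ ball z R := ball_subset_ball (by linarith)
  have hGd : DifferentiableOn ℂ G (ball z (R / 2)) :=
    hu'.tendstoLocallyUniformlyOn.differentiableOn
      (Eventually.of_forall fun k ↦ (hF k).mono hsub) isOpen_ball
  have hnhds : ball z (R / 2) ∈ 𝓝 z := ball_mem_nhds z (by linarith)
  have hev : v =ᶠ[𝓝 z] fun w ↦ (G w).re := by
    filter_upwards [hnhds] with w hw
    refine tendsto_nhds_unique (hlim'.tendsto_at (hsub hw)) ?_
    refine ((Complex.continuous_re.tendsto _).comp (hG w hw)).congr fun k ↦ ?_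
    simp [hre k w (hsub hw)]
  exact (harmonicAt_congr_nhds hev).2 (hGd.analyticAt hnhds).harmonicAt_re

variable {n : ℕ}

lemma harmonicAt_euclidean {f : ℂ → EuclideanSpace ℝ (Fin n)} {z : ℂ} :
    HarmonicAt f z ↔ ∀ i, HarmonicAt (fun w ↦ f w i) z := by
  refine ⟨fun h i ↦ h.comp_CLM (EuclideanSpace.proj (𝕜 := ℝ) i : EuclideanSpace ℝ (Fin n) →L[ℝ] ℝ),
    fun h ↦ ?_⟩
  have hc : ContDiffAt ℝ 2 f z := contDiffAt_euclidean.2 fun i ↦ (h i).1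
  refine ⟨hc, ?_⟩
  have h2 := eventually_all.2 fun i ↦ (h i).2
  have h3 := eventually_all.2 fun i ↦
    hc.laplacian_CLM_comp_left_nhds
      (l := (EuclideanSpace.proj (𝕜 := ℝ) i : EuclideanSpace ℝ (Fin n) →L[ℝ] ℝ))
  filter_upwards [h2, h3] with w hw hw'
  ext i
  have e : Laplacian.laplacian (fun w ↦ f w i) w = Laplacian.laplacian f w i := hw' i
  rw [← e, hw i]
  rfl

lemma contDiffAt_of_harmonicAt {f : ℂ → EuclideanSpace ℝ (Fin n)} {z : ℂ}
    (h : HarmonicAt f z) (j : ℕ) : ContDiffAt ℝ j f z :=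
  contDiffAt_euclidean.2 fun i ↦ (HarmonicAt.analyticAt (harmonicAt_euclidean.1 h i)).contDiffAt

lemma exists_norm_iteratedFDeriv_le (n j : ℕ) {R : ℝ} (hR : 0 < R) :
    ∃ C : ℝ, 0 < C ∧ ∀ (f : ℂ → EuclideanSpace ℝ (Fin n)) (z : ℂ) (B : ℝ), 0 < B →
      HarmonicOnNhd f (ball z R) → (∀ w ∈ ball z R, ‖f w‖ ≤ B) →
      ‖iteratedFDeriv ℝ j f z‖ ≤ C * B := by
  obtain ⟨C, hC, h⟩ := exists_norm_iteratedFDeriv_le_real j hR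
  refine ⟨C, hC, fun f z B hB hf hb ↦ ?_⟩
  refine ContinuousMultilinearMap.opNorm_le_bound (by positivity) fun v ↦ ?_
  have hv : 0 ≤ ∏ i, ‖v i‖ := Finset.prod_nonneg fun i _ ↦ norm_nonneg _
  -- Testing against linear functionals reduces to the scalar estimate with the same constant.
  refine NormedSpace.norm_le_dual_bound ℝ _ (by positivity) fun l ↦ ?_
  rcases eq_or_ne l 0 with rfl | hl
  · simp
  have hl' : 0 < ‖l‖ := norm_pos_iff.2 hl
  have h1 : iteratedFDeriv ℝ j (l ∘ f) z = l.compContinuousMultilinearMap (iteratedFDeriv ℝ j f z) :=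
    l.iteratedFDeriv_comp_left
      (contDiffAt_of_harmonicAt (hf z (mem_ball_self hR)) j) le_rfl
  have h2 := h (l ∘ f) z (‖l‖ * B) (by positivity) (hf.comp_CLM l) fun w hw ↦
    (l.le_opNorm _).trans (by gcongr; exact hb w hw)
  calc ‖l (iteratedFDeriv ℝ j f z v)‖ = ‖iteratedFDeriv ℝ j (l ∘ f) z v‖ := by rw [h1]; rfl
    _ ≤ ‖iteratedFDeriv ℝ j (l ∘ f) z‖ * ∏ i, ‖v i‖ := ContinuousMultilinearMap.le_opNorm _ _
    _ ≤ C * (‖l‖ * B) * ∏ i, ‖v i‖ := by gcongr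
    _ = C * B * (∏ i, ‖v i‖) * ‖l‖ := by ring

lemma harmonicAt_of_tendstoUniformlyOn {f : ℕ → ℂ → EuclideanSpace ℝ (Fin n)}
    {g : ℂ → EuclideanSpace ℝ (Fin n)} {s : Set ℂ} {z : ℂ} (hs : s ∈ 𝓝 z)
    (hf : ∀ᶠ k in atTop, HarmonicOnNhd (f k) s) (hlim : TendstoUniformlyOn f g atTop s) :
    HarmonicAt g z := by
  obtain ⟨R, hR, hRs⟩ := Metric.mem_nhds_iff.1 hs
  refine harmonicAt_euclidean.2 fun i ↦
    harmonicAt_of_tendstoUniformlyOn_real hR (u := fun k w ↦ f k w i) ?_ ?_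
  · filter_upwards [hf] with k hk w hw
    exact harmonicAt_euclidean.1 (hk w (hRs hw)) i
  · rw [Metric.tendstoUniformlyOn_iff] at hlim ⊢
    intro ε hε
    filter_upwards [hlim ε hε] with k hk w hw
    refine lt_of_le_of_lt ?_ (hk w (hRs hw))
    rw [dist_eq_norm, dist_eq_norm]
    exact PiLp.norm_apply_le (g w - f k w) i

/-- The interior estimate applied to the harmonic maps `f k - g` turns uniform smallness into
smallness of derivatives. -/
lemma tendsto_iteratedFDeriv_of_tendstoUniformlyOn {f : ℕ → ℂ → EuclideanSpace ℝ (Fin n)}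
    {g : ℂ → EuclideanSpace ℝ (Fin n)} {s : Set ℂ} {z : ℂ} (hs : s ∈ 𝓝 z)
    (hf : ∀ᶠ k in atTop, HarmonicOnNhd (f k) s) (hlim : TendstoUniformlyOn f g atTop s) (j : ℕ) :
    Tendsto (fun k ↦ iteratedFDeriv ℝ j (f k) z) atTop (𝓝 (iteratedFDeriv ℝ j g z)) := by
  obtain ⟨R, hR, hRs⟩ := Metric.mem_nhds_iff.1 hs
  have hg : HarmonicOnNhd g (ball z R) := fun w hw ↦
    harmonicAt_of_tendstoUniformlyOn (mem_of_superset (isOpen_ball.mem_nhds hw) hRs) hf hlim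
  obtain ⟨C, hC, h⟩ := exists_norm_iteratedFDeriv_le n j hR
  rw [Metric.tendsto_nhds]
  intro ε hε
  filter_upwards [hf, Metric.tendstoUniformlyOn_iff.1 hlim (ε / (2 * C)) (by positivity)]
    with k hk hk'
  have hk2 : HarmonicOnNhd (f k) (ball z R) := hk.mono hRs
  have hz := mem_ball_self (x := z) hR
  rw [dist_eq_norm, ← iteratedFDeriv_sub_apply (contDiffAt_of_harmonicAt (hk2 z hz) j)
    (contDiffAt_of_harmonicAt (hg z hz) j)]
  refine (h _ z (ε / (2 * C)) (by positivity) (hk2.sub hg) fun w hw ↦ ?_).trans_lt ?_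
  · have := (hk' w (hRs hw)).le
    rwa [dist_comm, dist_eq_norm] at this
  · have : C * (ε / (2 * C)) = ε / 2 := by field_simp
    linarith

lemma tendsto_fderiv_of_tendstoUniformlyOn {f : ℕ → ℂ → EuclideanSpace ℝ (Fin n)}
    {g : ℂ → EuclideanSpace ℝ (Fin n)} {s : Set ℂ} {z : ℂ} (hs : s ∈ 𝓝 z)
    (hf : ∀ᶠ k in atTop, HarmonicOnNhd (f k) s) (hlim : TendstoUniformlyOn f g atTop s) (v : ℂ) :
    Tendsto (fun k ↦ fderiv ℝ (f k) z v) atTop (𝓝 (fderiv ℝ g z v)) := by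
  have h := tendsto_iteratedFDeriv_of_tendstoUniformlyOn hs hf hlim 1
  have h' := ((ContinuousMultilinearMap.apply ℝ (fun _ : Fin 1 ↦ ℂ) _
    (fun _ ↦ v)).continuous.tendsto _).comp h
  simpa [Function.comp_def, iteratedFDeriv_one_apply] using h'

/-- A uniform limit of conformal harmonic maps is conformal where its differential does not
vanish. -/
lemma conformalAt_of_tendstoUniformlyOn {f : ℕ → ℂ → EuclideanSpace ℝ (Fin n)}
    {g : ℂ → EuclideanSpace ℝ (Fin n)} {s : Set ℂ} {z : ℂ} (hs : s ∈ 𝓝 z)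
    (hf : ∀ᶠ k in atTop, HarmonicOnNhd (f k) s) (hlim : TendstoUniformlyOn f g atTop s)
    (hconf : ∀ᶠ k in atTop, ConformalAt (f k) z) (hg : fderiv ℝ g z ≠ 0) : ConformalAt g z := by
  rw [conformalAt_iff_isConformalMap_fderiv, isConformalMap_iff]
  have ht := tendsto_fderiv_of_tendstoUniformlyOn hs hf hlim
  -- With the conformal factor written as the squared length of the image of `1`, conformality is a
  -- closed condition. Only positivity of the factor can fail in the limit, and then the
  -- differential is zero.
  have key : ∀ u v : ℂ, inner ℝ (fderiv ℝ g z u) (fderiv ℝ g z v) =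
      inner ℝ (fderiv ℝ g z 1) (fderiv ℝ g z 1) * inner ℝ u v := by
    intro u v
    refine tendsto_nhds_unique ((ht u).inner (ht v)) ?_
    refine (((ht 1).inner (ht 1)).mul_const (inner ℝ u v)).congr' ?_
    filter_upwards [hconf] with k hk
    rw [conformalAt_iff_isConformalMap_fderiv, isConformalMap_iff] at hk
    obtain ⟨c, -, hc⟩ := hk
    rw [hc, hc]
    simp
  refine ⟨_, ?_, key⟩
  refine lt_of_le_of_ne real_inner_self_nonneg fun h0 ↦ hg ?_
  ext1 u
  have := key u u
  rw [← h0, zero_mul] at this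
  simpa using inner_self_eq_zero.1 this

end Harmonic

/-! ### Topology of surfaces: Runge sets and exhaustions. -/

section Runge

/-- A punctured disc is connected: it is the image of a half-plane under the exponential map. -/
lemma isPreconnected_ball_diff_center (c : ℂ) (r : ℝ) : IsPreconnected (ball c r \ {c}) := by
  rcases le_or_gt r 0 with hr | hr
  · simp [ball_eq_empty.2 hr, isPreconnected_empty]
  have h : ball c r \ {c} = (fun w ↦ c + Complex.exp w) '' {w : ℂ | w.re < Real.log r} := by
    ext z
    simp only [Set.mem_sdiff, mem_ball, dist_eq_norm, Set.mem_singleton_iff, Set.mem_image,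
      Set.mem_ofPred_eq]
    constructor
    · rintro ⟨hz, hne⟩
      have hne' : z - c ≠ 0 := sub_ne_zero.2 hne
      refine ⟨Complex.log (z - c), ?_, by rw [Complex.exp_log hne']; ring⟩
      rw [Complex.log_re]
      exact Real.log_lt_log (norm_pos_iff.2 hne') hz
    · rintro ⟨w, hw, rfl⟩
      refine ⟨?_, by simp⟩
      rw [add_sub_cancel_left, Complex.norm_exp]
      exact (Real.lt_log_iff_exp_lt hr).1 hw
  rw [h]
  exact (convex_halfSpace_re_lt _).isPreconnected.image _ (by fun_prop)

variable {M : Type u} [TopologicalSpace M]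

/-- A punctured disc in a chart serves as `P`. This is why deleting a point does not separate a
surface locally. -/
lemma exists_isPreconnected_punctured_nhd [ChartedSpace ℂ M] {p : M} {N : Set M} (hN : N ∈ 𝓝 p) :
    ∃ P ⊆ N, p ∉ P ∧ IsPreconnected P ∧ insert p P ∈ 𝓝 p := by
  set φ := chartAt ℂ p
  have hp : p ∈ φ.source := mem_chart_source ℂ p
  have h1 : φ.target ∩ φ.symm ⁻¹' N ∈ 𝓝 (φ p) := by
    refine inter_mem (φ.open_target.mem_nhds (φ.map_source hp)) ?_
    refine (φ.continuousAt_symm (φ.map_source hp)).preimage_mem_nhds ?_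
    rwa [φ.left_inv hp]
  obtain ⟨r, hr, hsub⟩ := Metric.mem_nhds_iff.1 h1
  refine ⟨φ.symm '' (ball (φ p) r \ {φ p}), ?_, ?_, ?_, ?_⟩
  · rintro _ ⟨z, hz, rfl⟩
    exact (hsub hz.1).2
  · rintro ⟨z, hz, h⟩
    exact hz.2 (by rw [← h, φ.right_inv (hsub hz.1).1]; rfl)
  · refine (isPreconnected_ball_diff_center _ _).image _ ?_
    exact φ.continuousOn_symm.mono fun z hz ↦ (hsub hz.1).1
  · filter_upwards [φ.open_source.mem_nhds hp,
      (φ.continuousAt hp).preimage_mem_nhds (ball_mem_nhds _ hr)] with q hq hq'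
    rcases eq_or_ne q p with rfl | hne
    · exact Set.mem_insert _ _
    · exact Or.inr ⟨φ q, ⟨hq', fun h ↦ hne (φ.injOn hq hp h)⟩, φ.left_inv hq⟩

lemma eq_connectedComponentIn_of_mem {S : Set M} {x y z : M} (hx : z ∈ connectedComponentIn S x)
    (hy : z ∈ connectedComponentIn S y) : connectedComponentIn S x = connectedComponentIn S y :=
  (connectedComponentIn_eq hx).trans (connectedComponentIn_eq hy).symm

/-- Adding finitely many points to a compact Runge set gives a compact Runge set. -/
lemma IsCompactRunge.union_finite [T2Space M] [ChartedSpace ℂ M] {K F : Set M}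
    (hK : IsCompactRunge K) (hF : F.Finite) : IsCompactRunge (K ∪ F) := by
  have := ChartedSpace.locallyConnectedSpace ℂ M
  refine ⟨hK.1.union hF.isCompact, fun x hx hc ↦ ?_⟩
  have hSo : IsOpen (K ∪ F)ᶜ := (hK.1.union hF.isCompact).isClosed.isOpen_compl
  set S := (K ∪ F)ᶜ
  set C := connectedComponentIn S x with hC
  have hSK : S ⊆ Kᶜ := Set.compl_subset_compl.2 Set.subset_union_left
  have hCS : C ⊆ S := connectedComponentIn_subset S x
  have hCo : IsOpen C := hSo.connectedComponentIn
  have hxC : x ∈ C := mem_connectedComponentIn hx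
  have hmem : ∀ p ∈ closure C, p ∈ S → p ∈ C := by
    intro p hp hpS
    obtain ⟨q, hq, hqC⟩ := mem_closure_iff.1 hp _ (hSo.connectedComponentIn (x := p))
      (mem_connectedComponentIn hpS)
    rw [hC, ← eq_connectedComponentIn_of_mem hq hqC]
    exact mem_connectedComponentIn hpS
  -- A limit point of `C` outside `K` and not in `C` lies in `F`; a small connected punctured
  -- neighbourhood of it avoids `K ∪ F` and meets `C`, hence lies in `C`.
  have hD : IsOpen (closure C ∩ Kᶜ) := by
    rw [isOpen_iff_mem_nhds]
    rintro p ⟨hpC, hpK⟩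
    by_cases hp : p ∈ C
    · filter_upwards [hCo.mem_nhds hp] with q hq using ⟨subset_closure hq, hSK (hCS hq)⟩
    have hN : Kᶜ ∩ (F \ {p})ᶜ ∈ 𝓝 p := by
      refine inter_mem (hK.1.isClosed.isOpen_compl.mem_nhds hpK) ?_
      exact (hF.subset Set.sdiff_subset).isClosed.isOpen_compl.mem_nhds (by simp)
    obtain ⟨P, hPN, hpP, hPc, hPn⟩ := exists_isPreconnected_punctured_nhd hN
    have hPS : P ⊆ S := by
      rintro q hq (hqK | hqF)
      · exact (hPN hq).1 hqK
      · exact (hPN hq).2 ⟨hqF, fun h ↦ hpP (h ▸ hq)⟩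
    obtain ⟨q, hq, hqC⟩ := mem_closure_iff_nhds.1 hpC _ hPn
    have hqP : q ∈ P := hq.resolve_left fun h ↦ hp (h ▸ hqC)
    have hPC : P ⊆ C := by
      rw [hC, connectedComponentIn_eq hqC]
      exact hPc.subset_connectedComponentIn hqP hPS
    filter_upwards [hPn] with y hy
    rcases hy with rfl | hy
    · exact ⟨hpC, hpK⟩
    · exact ⟨subset_closure (hPC hy), hSK (hPS hy)⟩
  -- This set is open and closed in `Kᶜ`, so it contains the whole component of `x`, which would
  -- then be relatively compact.
  have hsub : connectedComponentIn Kᶜ x ⊆ closure C ∩ Kᶜ := by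
    refine isPreconnected_connectedComponentIn.subset_left_of_subset_union hD
      (isClosed_closure (s := C)).isOpen_compl ?_ ?_ ⟨x, mem_connectedComponentIn (hSK hx),
        subset_closure hxC, hSK hx⟩
    · exact Set.disjoint_left.2 fun p hp hp' ↦ hp' hp.1
    · intro p hp
      by_cases h : p ∈ closure C
      · exact Or.inl ⟨h, connectedComponentIn_subset _ _ hp⟩
      · exact Or.inr h
  exact hK.2 x (hSK hx) (hc.of_isClosed_subset isClosed_closure
    (closure_minimal (hsub.trans Set.inter_subset_left) isClosed_closure))

/-- Filling in the relatively compact complementary components of a compact set. -/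
lemma exists_isCompactRunge_superset [T2Space M] [LocallyCompactSpace M] [LocallyConnectedSpace M]
    [ConnectedSpace M] {L : Set M} (hL : IsCompact L) :
    ∃ K, IsCompactRunge K ∧ L ⊆ interior K := by
  obtain ⟨x₀⟩ := (inferInstance : Nonempty M)
  -- The point `x₀` keeps `W` nonempty, so no component of `Wᶜ` is all of `M`.
  obtain ⟨W, hW, hLW⟩ := exists_compact_superset (hL.union (isCompact_singleton (x := x₀)))
  obtain ⟨V, hV, hWV⟩ := exists_compact_superset hW
  have hWo : IsOpen Wᶜ := hW.isClosed.isOpen_compl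
  set C := connectedComponentIn Wᶜ with hC
  have hCo : ∀ x, IsOpen (C x) := fun x ↦ hWo.connectedComponentIn
  have hmem : ∀ {x}, x ∉ W → x ∈ C x := fun hx ↦ mem_connectedComponentIn hx
  have heq : ∀ {x y}, y ∈ C x → C x = C y := fun h ↦ connectedComponentIn_eq h
  set K := {x | IsCompact (closure (C x))} with hK
  have hWK : W ⊆ K := by
    intro x hx
    have : C x = ∅ := connectedComponentIn_eq_empty (by simpa using hx)
    simp [hK, this]
  have hCK : ∀ x ∉ K, C x ⊆ Kᶜ := by
    intro x hx y hy hyK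
    rw [hK, Set.mem_ofPred_eq, ← heq hy] at hyK
    exact hx hyK
  have hKc : IsClosed K := by
    rw [← isOpen_compl_iff, isOpen_iff_mem_nhds]
    exact fun x hx ↦ mem_of_superset ((hCo x).mem_nhds (hmem fun h ↦ hx (hWK h))) (hCK x hx)
  have hfr : frontier (interior V) ⊆ Wᶜ := by
    intro y hy hyW
    exact (disjoint_interior_frontier (s := interior V)).le_bot
      ⟨by rw [interior_interior]; exact hWV hyW, hy⟩
  have hfrc : IsCompact (frontier (interior V)) :=
    hV.of_isClosed_subset isClosed_frontier
      (frontier_subset_closure.trans (closure_minimal interior_subset hV.isClosed))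
  -- Every component of `Wᶜ` not contained in `V` meets this compact frontier, so there are only
  -- finitely many of them; hence the filled set is compact.
  obtain ⟨t, ht, htc⟩ := hfrc.elim_nhds_subcover C fun y hy ↦ (hCo y).mem_nhds (hmem (hfr hy))
  have hKsub : K ⊆ V ∪ ⋃ y ∈ {y ∈ (t : Set M) | y ∈ K}, closure (C y) := by
    intro x hx
    by_cases hxV : x ∈ V
    · exact Or.inl hxV
    have hxW : x ∉ W := fun h ↦ hxV (interior_subset (hWV h))
    have hmeet : (C x ∩ interior V).Nonempty := by
      by_contra hne
      -- A component missing `interior V` would have its closure in `Wᶜ`, so it would be clopen and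
      -- contain `x₀`.
      have hd : C x ⊆ (interior V)ᶜ := fun y hy hyV ↦ hne ⟨y, hy, hyV⟩
      have hcl : closure (C x) ⊆ C x := by
        refine isPreconnected_connectedComponentIn.closure.subset_connectedComponentIn
          (subset_closure (hmem hxW)) ?_
        exact (closure_minimal hd isOpen_interior.isClosed_compl).trans
          (Set.compl_subset_compl.2 hWV)
      have hclopen : IsClopen (C x) := ⟨isClosed_of_closure_subset hcl, hCo x⟩
      have huniv := hclopen.eq_univ ⟨x, hmem hxW⟩
      have : x₀ ∈ C x := huniv ▸ Set.mem_univ x₀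
      exact connectedComponentIn_subset _ _ this (interior_subset (hLW (Or.inr rfl)))
    obtain ⟨y, hyC, hyf⟩ : (C x ∩ frontier (interior V)).Nonempty := by
      by_contra hne
      have hcov : C x ⊆ interior V ∪ (closure (interior V))ᶜ := by
        intro y hy
        by_cases h : y ∈ interior V
        · exact Or.inl h
        · refine Or.inr fun h' ↦ hne ⟨y, hy, h', ?_⟩
          rwa [interior_interior]
      have := isPreconnected_connectedComponentIn.subset_left_of_subset_union isOpen_interior
        (isClosed_closure (s := interior V)).isOpen_compl
        (Set.disjoint_left.2 fun y hy h ↦ h (subset_closure hy)) hcov hmeet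
      exact hxV (interior_subset (this (hmem hxW)))
    obtain ⟨z, hz, hyz⟩ := Set.mem_iUnion₂.1 (htc hyf)
    have hxz : C x = C z := eq_connectedComponentIn_of_mem hyC hyz
    refine Or.inr (Set.mem_iUnion₂.2 ⟨z, ⟨hz, ?_⟩, subset_closure (hxz ▸ hmem hxW)⟩)
    rw [hK, Set.mem_ofPred_eq, ← hxz]
    exact hx
  have hKcomp : IsCompact K := by
    refine IsCompact.of_isClosed_subset (hV.union ?_) hKc hKsub
    exact (t.finite_toSet.subset (Set.sep_subset _ _)).isCompact_biUnion fun y hy ↦ hy.2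
  refine ⟨K, ⟨hKcomp, fun x hx hc ↦ hx ?_⟩,
    Set.subset_union_left.trans (hLW.trans (interior_mono hWK))⟩
  refine hc.of_isClosed_subset isClosed_closure (closure_mono ?_)
  exact isPreconnected_connectedComponentIn.subset_connectedComponentIn
    (hmem fun h ↦ hx (hWK h)) (hCK x hx)

/-- An exhaustion by compact Runge sets with a prescribed first member. -/
lemma exists_runge_exhaustion [T2Space M] [SecondCountableTopology M] [LocallyCompactSpace M]
    [LocallyConnectedSpace M] [ConnectedSpace M] {K : Set M} (hK : IsCompactRunge K) :
    ∃ E : ℕ → Set M, E 0 = K ∧ (∀ i, IsCompactRunge (E i)) ∧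
      (∀ i, E i ⊆ interior (E (i + 1))) ∧ ∀ x, ∃ i, x ∈ E i := by
  have hstep : ∀ (i : ℕ) (L : {L : Set M // IsCompactRunge L}), ∃ L' : {L : Set M // IsCompactRunge L},
      L.1 ∪ compactCovering M i ⊆ interior L'.1 := fun i L ↦ by
    obtain ⟨L', h, h'⟩ := exists_isCompactRunge_superset
      (L.2.1.union (isCompact_compactCovering M i))
    exact ⟨⟨L', h⟩, h'⟩
  choose s hs using hstep
  let E : ℕ → {L : Set M // IsCompactRunge L} := fun i ↦ Nat.rec ⟨K, hK⟩ s i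
  refine ⟨fun i ↦ (E i).1, rfl, fun i ↦ (E i).2,
    fun i ↦ Set.subset_union_left.trans (hs i (E i)), fun x ↦ ?_⟩
  obtain ⟨i, hi⟩ := Set.mem_iUnion.1 ((iUnion_compactCovering M).symm ▸ Set.mem_univ x)
  exact ⟨i + 1, interior_subset (hs i (E i) (Or.inr hi))⟩

end Runge

/-! ### Transfer to surfaces: charts, stability and limits. -/

section Charts

variable {M : Type u} [TopologicalSpace M] {n : ℕ}

lemma eventuallyEq_comp_symm {X : Type*} (φ : OpenPartialHomeomorph M ℂ) {f g : M → X} {x : M}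
    (hx : x ∈ φ.source) (h : f =ᶠ[𝓝 x] g) : f ∘ φ.symm =ᶠ[𝓝 (φ x)] g ∘ φ.symm := by
  have ht : Tendsto φ.symm (𝓝 (φ x)) (𝓝 x) := by
    have := φ.continuousAt_symm (φ.map_source hx)
    rwa [ContinuousAt, φ.left_inv hx] at this
  exact h.comp_tendsto ht

lemma isOpen_chart_preimage (φ : OpenPartialHomeomorph M ℂ) {W : Set M} (hW : IsOpen W) :
    IsOpen (φ.target ∩ φ.symm ⁻¹' W) := φ.isOpen_inter_preimage_symm hW

lemma mem_chart_preimage (φ : OpenPartialHomeomorph M ℂ) {W : Set M} {x : M} (hx : x ∈ φ.source)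
    (hxW : x ∈ W) : φ x ∈ φ.target ∩ φ.symm ⁻¹' W :=
  ⟨φ.map_source hx, by rwa [Set.mem_preimage, φ.left_inv hx]⟩

lemma tendstoUniformlyOn_comp_symm {X : Type*} [UniformSpace X] {F : ℕ → M → X} {g : M → X}
    {W : Set M} (hlim : TendstoUniformlyOn F g atTop W) (φ : OpenPartialHomeomorph M ℂ) :
    TendstoUniformlyOn (fun k ↦ F k ∘ φ.symm) (g ∘ φ.symm) atTop (φ.target ∩ φ.symm ⁻¹' W) :=
  (hlim.comp φ.symm).mono Set.inter_subset_right

variable [ChartedSpace ℂ M] {f g h : M → EuclideanSpace ℝ (Fin n)} {U V W : Set M} {p : M}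

/-- Harmonicity in all charts of the atlas. -/
def IsHarmonicOn (f : M → EuclideanSpace ℝ (Fin n)) (U : Set M) : Prop :=
  ∀ φ ∈ atlas ℂ M, ∀ x ∈ U ∩ φ.source, HarmonicAt (f ∘ φ.symm) (φ x)

lemma IsConformalHarmonicImmersionOn.isHarmonicOn (hf : IsConformalHarmonicImmersionOn f U) :
    IsHarmonicOn f U := fun φ hφ x hx ↦ (hf φ hφ x hx).1

lemma IsConformalHarmonicImmersionOn.mono (hf : IsConformalHarmonicImmersionOn f U) (hVU : V ⊆ U) :
    IsConformalHarmonicImmersionOn f V := fun φ hφ x hx ↦ hf φ hφ x ⟨hVU hx.1, hx.2⟩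

lemma IsConformalHarmonicImmersionOn.congr (hf : IsConformalHarmonicImmersionOn f U)
    (hU : IsOpen U) (h : U.EqOn g f) : IsConformalHarmonicImmersionOn g U := by
  intro φ hφ x hx
  have hev := eventuallyEq_comp_symm φ hx.2 (h.eventuallyEq_of_mem (hU.mem_nhds hx.1))
  obtain ⟨h1, f', hf', hc⟩ := hf φ hφ x hx
  exact ⟨(harmonicAt_congr_nhds hev).2 h1, f', hf'.congr_of_eventuallyEq hev, hc⟩

lemma IsConformalHarmonicImmersionOn.union (hU : IsConformalHarmonicImmersionOn f U)
    (hV : IsConformalHarmonicImmersionOn f V) : IsConformalHarmonicImmersionOn f (U ∪ V) :=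
  fun φ hφ x hx ↦ hx.1.elim (fun h ↦ hU φ hφ x ⟨h, hx.2⟩) fun h ↦ hV φ hφ x ⟨h, hx.2⟩

lemma AgreeToOrder.of_eventuallyEq (h : f =ᶠ[𝓝 p] g) (m : ℕ) : AgreeToOrder m f g p :=
  fun φ _ hp j _ ↦ ((eventuallyEq_comp_symm φ hp h).iteratedFDeriv ℝ j).eq_of_nhds

lemma AgreeToOrder.trans {m : ℕ} (h₁ : AgreeToOrder m f g p) (h₂ : AgreeToOrder m g h p) :
    AgreeToOrder m f h p :=
  fun φ hφ hp j hj ↦ (h₁ φ hφ hp j hj).trans (h₂ φ hφ hp j hj)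

lemma AgreeToOrder.mono {m k : ℕ} (hf : AgreeToOrder m f g p) (hk : k ≤ m) :
    AgreeToOrder k f g p := fun φ hφ hp j hj ↦ hf φ hφ hp j (hj.trans hk)

lemma IsHarmonicOn.harmonicOnNhd (hf : IsHarmonicOn f U) {φ : OpenPartialHomeomorph M ℂ}
    (hφ : φ ∈ atlas ℂ M) : HarmonicOnNhd (f ∘ φ.symm) (φ.target ∩ φ.symm ⁻¹' U) := by
  intro z hz
  simpa [φ.right_inv hz.1] using hf φ hφ (φ.symm z) ⟨hz.2, φ.map_target hz.1⟩

lemma IsHarmonicOn.continuousOn (hf : IsHarmonicOn f U) : ContinuousOn f U := by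
  intro x hx
  have hs := mem_chart_source ℂ x
  have h1 : ContinuousAt (f ∘ (chartAt ℂ x).symm) (chartAt ℂ x x) :=
    (hf _ (chart_mem_atlas ℂ x) x ⟨hx, hs⟩).1.continuousAt
  have h2 := h1.comp ((chartAt ℂ x).continuousAt hs)
  refine (h2.congr ?_).continuousWithinAt
  filter_upwards [(chartAt ℂ x).open_source.mem_nhds hs] with y hy
  simp [(chartAt ℂ x).left_inv hy]

/-- Conformality can be tested in a single chart. -/
lemma conformalAt_of_chart [HasGroupoid M (conformalGroupoid (X := ℂ))]
    {φ ψ : OpenPartialHomeomorph M ℂ} (hφ : φ ∈ atlas ℂ M) (hψ : ψ ∈ atlas ℂ M)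
    (hpφ : p ∈ φ.source) (hpψ : p ∈ ψ.source) (hf : ConformalAt (f ∘ ψ.symm) (ψ p)) :
    ConformalAt (f ∘ φ.symm) (φ p) := by
  have hg := HasGroupoid.compatible (G := conformalGroupoid (X := ℂ)) hφ hψ
  have hmem : φ p ∈ (φ.symm.trans ψ).source := by
    simp [hpφ, hpψ]
  have h1 : ConformalAt (φ.symm.trans ψ) (φ p) := (mem_groupoid_of_pregroupoid.1 hg).1 _ hmem
  have h2 : ConformalAt ((f ∘ ψ.symm) ∘ (φ.symm.trans ψ)) (φ p) := by
    refine ConformalAt.comp _ ?_ h1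
    simpa [φ.left_inv hpφ] using hf
  refine h2.congr hmem (φ.symm.trans ψ).open_source fun z hz ↦ ?_
  have hz' : φ.symm z ∈ ψ.source := by
    rw [OpenPartialHomeomorph.trans_source] at hz
    exact hz.2
  simp [ψ.left_inv hz']

/-- A map that is uniformly close to a conformal harmonic immersion near a compact set and harmonic
has nonvanishing differential there. -/
lemma exists_pos_fderiv_ne_zero {K L : Set M} (hg : IsConformalHarmonicImmersionOn g K)
    (hL : IsCompact L) (hLK : L ⊆ interior K) :
    ∃ δ : ℝ, 0 < δ ∧ ∀ h : M → EuclideanSpace ℝ (Fin n), IsHarmonicOn h (interior K) →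
      (∀ p ∈ K, ‖h p - g p‖ ≤ δ) →
      ∀ y ∈ L, ∃ φ ∈ atlas ℂ M, y ∈ φ.source ∧ fderiv ℝ (h ∘ φ.symm) (φ y) ≠ 0 := by
  refine hL.induction_on (p := fun S ↦ ∃ δ : ℝ, 0 < δ ∧ ∀ h : M → EuclideanSpace ℝ (Fin n),
    IsHarmonicOn h (interior K) → (∀ p ∈ K, ‖h p - g p‖ ≤ δ) →
      ∀ y ∈ S, ∃ φ ∈ atlas ℂ M, y ∈ φ.source ∧ fderiv ℝ (h ∘ φ.symm) (φ y) ≠ 0) ?_ ?_ ?_ ?_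
  · exact ⟨1, one_pos, fun _ _ _ y hy ↦ hy.elim⟩
  · rintro S T hST ⟨δ, hδ, h⟩
    exact ⟨δ, hδ, fun k hk hk' y hy ↦ h k hk hk' y (hST hy)⟩
  · rintro S T ⟨δ, hδ, h⟩ ⟨δ', hδ', h'⟩
    refine ⟨min δ δ', lt_min hδ hδ', fun k hk hk' y hy ↦ hy.elim
      (h k hk (fun p hp ↦ (hk' p hp).trans (min_le_left _ _)) y)
      (h' k hk (fun p hp ↦ (hk' p hp).trans (min_le_right _ _)) y)⟩
  intro x hx
  set φ := chartAt ℂ x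
  have hφ : φ ∈ atlas ℂ M := chart_mem_atlas ℂ x
  have hxs : x ∈ φ.source := mem_chart_source ℂ x
  set s := φ.target ∩ φ.symm ⁻¹' interior K
  have hs : s ∈ 𝓝 (φ x) :=
    (isOpen_chart_preimage φ isOpen_interior).mem_nhds (mem_chart_preimage φ hxs (hLK hx))
  have hgs : HarmonicOnNhd (g ∘ φ.symm) s :=
    (hg.mono interior_subset).isHarmonicOn.harmonicOnNhd hφ
  obtain ⟨hgh, hgc⟩ := hg φ hφ x ⟨interior_subset (hLK hx), hxs⟩
  have hne : fderiv ℝ (g ∘ φ.symm) (φ x) ≠ 0 := by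
    obtain ⟨c, hc, hi⟩ := (isConformalMap_iff _).1 (conformalAt_iff_isConformalMap_fderiv.1 hgc)
    intro h0
    have := hi 1 1
    simp [h0] at this
    exact hc.ne this
  have hcont : ContinuousAt (fderiv ℝ (g ∘ φ.symm)) (φ x) :=
    (hgh.1.fderiv_right (m := 1) (by norm_num)).continuousAt
  set d := ‖fderiv ℝ (g ∘ φ.symm) (φ x)‖
  have hdpos : 0 < d := norm_pos_iff.2 hne
  have hev : ∀ᶠ z in 𝓝 (φ x), d / 2 < ‖fderiv ℝ (g ∘ φ.symm) z‖ :=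
    hcont.norm.eventually_const_lt (by linarith)
  obtain ⟨R, hR, hRs⟩ := Metric.mem_nhds_iff.1 (inter_mem hs hev)
  obtain ⟨C, hC, hest⟩ := exists_norm_iteratedFDeriv_le n 1 (half_pos hR)
  -- Closeness within `d / (4 * C)` makes the differentials differ by at most `d / 4`, while that of
  -- `g` exceeds `d / 2`.
  refine ⟨φ.source ∩ φ ⁻¹' ball (φ x) (R / 2), mem_nhdsWithin_of_mem_nhds ?_,
    d / (4 * C), by positivity, ?_⟩
  · exact inter_mem (φ.open_source.mem_nhds hxs)
      ((φ.continuousAt hxs).preimage_mem_nhds (ball_mem_nhds _ (half_pos hR)))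
  rintro h hh hclose y ⟨hys, hyb⟩
  refine ⟨φ, hφ, hys, fun h0 ↦ ?_⟩
  have hsub : ball (φ y) (R / 2) ⊆ ball (φ x) R := by
    refine ball_subset_ball' ?_
    have : dist (φ y) (φ x) < R / 2 := hyb
    linarith
  have hhs : HarmonicOnNhd (h ∘ φ.symm) s := hh.harmonicOnNhd hφ
  have hy := mem_ball_self (x := φ y) (half_pos hR)
  have hys' := (hRs (hsub hy)).1
  have hb := hest (h ∘ φ.symm - g ∘ φ.symm) (φ y) (d / (4 * C)) (by positivity)
    (fun z hz ↦ (hhs z (hRs (hsub hz)).1).sub (hgs z (hRs (hsub hz)).1))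
    (fun z hz ↦ hclose _ (interior_subset (hRs (hsub hz)).1.2))
  rw [norm_iteratedFDeriv_one, fderiv_sub ((hhs _ hys').1.differentiableAt (by norm_num))
    ((hgs _ hys').1.differentiableAt (by norm_num)), h0, zero_sub, norm_neg] at hb
  have h1 : d / 2 < ‖fderiv ℝ (g ∘ φ.symm) (φ y)‖ := (hRs (hsub hy)).2
  have h2 : C * (d / (4 * C)) = d / 4 := by field_simp
  linarith

lemma exists_pos_mapsTo {X : Type*} [TopologicalSpace X] {E : Type*} [NormedAddCommGroup E]
    {g : X → E} {K : Set X} {Ω : Set E} (hK : IsCompact K) (hg : ContinuousOn g K)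
    (hΩ : IsOpen Ω) (hgΩ : Set.MapsTo g K Ω) :
    ∃ δ : ℝ, 0 < δ ∧ ∀ h : X → E, (∀ p ∈ K, ‖h p - g p‖ ≤ δ) → Set.MapsTo h K Ω := by
  obtain ⟨δ, hδ, h⟩ := (hK.image_of_continuousOn hg).exists_cthickening_subset_open hΩ
    hgΩ.image_subset
  refine ⟨δ, hδ, fun k hk p hp ↦ h ?_⟩
  exact mem_cthickening_of_dist_le _ (g p) _ _ (Set.mem_image_of_mem g hp)
    (by rw [dist_eq_norm]; exact hk p hp)

section Limit

variable {F : ℕ → M → EuclideanSpace ℝ (Fin n)}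

lemma isHarmonicOn_of_tendstoUniformlyOn (hW : IsOpen W) (hF : ∀ᶠ k in atTop, IsHarmonicOn (F k) W)
    (hlim : TendstoUniformlyOn F g atTop W) : IsHarmonicOn g W := by
  intro φ hφ x hx
  exact harmonicAt_of_tendstoUniformlyOn
    ((isOpen_chart_preimage φ hW).mem_nhds (mem_chart_preimage φ hx.2 hx.1))
    (hF.mono fun k hk ↦ hk.harmonicOnNhd hφ) (tendstoUniformlyOn_comp_symm hlim φ)

lemma agreeToOrder_of_tendstoUniformlyOn (hW : IsOpen W) (hp : p ∈ W)
    (hF : ∀ᶠ k in atTop, IsHarmonicOn (F k) W) (hlim : TendstoUniformlyOn F g atTop W) {m : ℕ}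
    (hagree : ∀ᶠ k in atTop, AgreeToOrder m (F k) f p) : AgreeToOrder m g f p := by
  intro φ hφ hpφ j hj
  refine tendsto_nhds_unique (tendsto_iteratedFDeriv_of_tendstoUniformlyOn
    ((isOpen_chart_preimage φ hW).mem_nhds (mem_chart_preimage φ hpφ hp))
    (hF.mono fun k hk ↦ hk.harmonicOnNhd hφ) (tendstoUniformlyOn_comp_symm hlim φ) j) ?_
  refine tendsto_const_nhds.congr' ?_
  filter_upwards [hagree] with k hk using (hk φ hφ hpφ j hj).symm

/-- The limit could acquire branch points, so nonvanishing of the differential is assumed, in one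
chart at each point; the stability estimate supplies it. -/
lemma isConformalHarmonicImmersionOn_of_tendstoUniformlyOn
    [HasGroupoid M (conformalGroupoid (X := ℂ))] (hW : IsOpen W) (hVW : V ⊆ W)
    (hF : ∀ᶠ k in atTop, IsConformalHarmonicImmersionOn (F k) W)
    (hlim : TendstoUniformlyOn F g atTop W)
    (hne : ∀ y ∈ V, ∃ φ ∈ atlas ℂ M, y ∈ φ.source ∧ fderiv ℝ (g ∘ φ.symm) (φ y) ≠ 0) :
    IsConformalHarmonicImmersionOn g V := by
  intro φ hφ x hx
  have hF' := hF.mono fun k hk ↦ hk.isHarmonicOn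
  refine ⟨isHarmonicOn_of_tendstoUniformlyOn hW hF' hlim φ hφ x ⟨hVW hx.1, hx.2⟩, ?_⟩
  obtain ⟨ψ, hψ, hxψ, hd⟩ := hne x hx.1
  refine conformalAt_of_chart hφ hψ hx.2 hxψ (conformalAt_of_tendstoUniformlyOn
    ((isOpen_chart_preimage ψ hW).mem_nhds (mem_chart_preimage ψ hxψ (hVW hx.1)))
    (hF'.mono fun k hk ↦ hk.harmonicOnNhd hψ) (tendstoUniformlyOn_comp_symm hlim ψ) ?_ hd)
  filter_upwards [hF] with k hk using (hk ψ hψ x ⟨hVW hx.1, hxψ⟩).2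

end Limit

end Charts

/-! ### The inductive construction and its limit. -/

/-- A sequence of maps whose successive differences are controlled on an exhaustion converges. -/
lemma exists_limit_of_exhaustion {X E : Type*} [NormedAddCommGroup E] [CompleteSpace E]
    {K : ℕ → Set X} (hmono : Monotone K) (hcov : ∀ x, ∃ i, x ∈ K i) {g : ℕ → X → E} {δ : ℕ → ℝ}
    (hδ : ∀ i, 0 < δ i) (hδ' : ∀ i, δ (i + 1) ≤ δ i / 2)
    (hg : ∀ i, ∀ p ∈ K i, ‖g (i + 1) p - g i p‖ ≤ δ i) :
    ∃ h : X → E, (∀ i, ∀ p ∈ K i, ‖h p - g i p‖ ≤ 2 * δ i) ∧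
      ∀ i, TendstoUniformlyOn g h atTop (K i) := by
  have hgeom : ∀ i, δ i ≤ δ 0 * (1 / 2) ^ i := by
    intro i
    induction i with
    | zero => simp
    | succ i ih => rw [pow_succ]; linarith [hδ' i]
  have hδlim : Tendsto δ atTop (𝓝 0) := by
    refine squeeze_zero (fun i ↦ (hδ i).le) hgeom ?_
    simpa using (tendsto_pow_atTop_nhds_zero_of_lt_one (r := (1 / 2 : ℝ)) (by norm_num)
      (by norm_num)).const_mul (δ 0)
  -- Halving gives `δ j ≤ 2 * δ j - 2 * δ (j + 1)`, so the errors telescope.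
  have htail : ∀ i, ∀ p ∈ K i, ∀ k, ‖g (i + k) p - g i p‖ ≤ 2 * δ i - 2 * δ (i + k) := by
    intro i p hp k
    induction k with
    | zero => simp
    | succ k ih =>
      have h1 := hg (i + k) p (hmono (Nat.le_add_right i k) hp)
      have h2 := norm_add_le (g (i + k + 1) p - g (i + k) p) (g (i + k) p - g i p)
      rw [sub_add_sub_cancel] at h2
      have h3 := hδ' (i + k)
      rw [← add_assoc]
      linarith
  have hconv : ∀ p, ∃ y, Tendsto (fun k ↦ g k p) atTop (𝓝 y) := by
    intro p
    obtain ⟨i, hi⟩ := hcov p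
    have hc : CauchySeq fun k ↦ g (i + k) p := by
      refine cauchySeq_of_le_geometric (1 / 2) (δ 0) (by norm_num) fun k ↦ ?_
      rw [dist_comm, dist_eq_norm]
      refine (hg (i + k) p (hmono (Nat.le_add_right i k) hi)).trans ((hgeom _).trans ?_)
      refine mul_le_mul_of_nonneg_left ?_ (hδ 0).le
      exact pow_le_pow_of_le_one (by norm_num) (by norm_num) (Nat.le_add_left k i)
    obtain ⟨y, hy⟩ := cauchySeq_tendsto_of_complete hc
    refine ⟨y, (tendsto_add_atTop_iff_nat i).1 ?_⟩
    simpa [add_comm] using hy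
  choose h hh using hconv
  have hbound : ∀ i, ∀ p ∈ K i, ‖h p - g i p‖ ≤ 2 * δ i := by
    intro i p hp
    refine le_of_tendsto ((hh p).sub_const (g i p)).norm ?_
    filter_upwards [eventually_ge_atTop i] with k hk
    obtain ⟨l, rfl⟩ := Nat.exists_eq_add_of_le hk
    linarith [htail i p hp l, hδ (i + l)]
  refine ⟨h, hbound, fun i ↦ Metric.tendstoUniformlyOn_iff.2 fun ε hε ↦ ?_⟩
  filter_upwards [eventually_ge_atTop i, hδlim.eventually_lt_const (half_pos hε)] with k hk hk' p hp
  rw [dist_eq_norm]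
  linarith [hbound k p (hmono hk hp)]

/-- Approximation on a compact Runge set with interpolation on a larger compact set, where the map
to be interpolated need only be defined near the additional points. -/
lemma IsFlexibleDomain.exists_approx {n : ℕ} {Ω : Set (EuclideanSpace ℝ (Fin n))}
    (hΩ : IsFlexibleDomain.{u} Ω)
    {M : Type u} [TopologicalSpace M] [T2Space M] [SecondCountableTopology M]
    [ConnectedSpace M] [NoncompactSpace M] [ChartedSpace ℂ M]
    [IsManifold 𝓘(ℝ, ℂ) ∞ M] [HasGroupoid M (conformalGroupoid (X := ℂ))]
    {U V K L A : Set M} {f g : M → EuclideanSpace ℝ (Fin n)} (hU : IsOpen U)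
    (hfΩ : Set.MapsTo f U Ω) (hf : IsConformalHarmonicImmersionOn f U) (hAU : A ⊆ U)
    (hAclosed : IsClosed A) (hAdiscrete : IsDiscrete A) (m : A → ℕ)
    (hK : IsCompactRunge K) (hL : IsCompact L) (hV : IsOpen V) (hKV : K ⊆ V)
    (hgΩ : Set.MapsTo g V Ω) (hg : IsConformalHarmonicImmersionOn g V)
    (hgf : ∀ a : A, (a : M) ∈ K → AgreeToOrder (m a) g f a) {δ : ℝ} (hδ : 0 < δ) :
    ∃ g' : M → EuclideanSpace ℝ (Fin n), (∀ p, g' p ∈ Ω) ∧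
      IsConformalHarmonicImmersionOn g' Set.univ ∧
      (∀ a : A, (a : M) ∈ L → AgreeToOrder (m a) g' f a) ∧ ∀ p ∈ K, ‖g' p - g p‖ < δ := by
  classical
  have hfin : (L ∩ A).Finite :=
    (hL.inter_right hAclosed).finite (hAdiscrete.mono Set.inter_subset_right)
  set F := (L ∩ A) \ K
  have hF : F.Finite := hfin.subset Set.sdiff_subset
  obtain ⟨N₁, N₂, hN₁, hN₂, hKN, hFN, hdisj⟩ :=
    SeparatedNhds.of_isCompact_isCompact hK.1 hF.isCompact Set.disjoint_sdiff_right
  set k : M → EuclideanSpace ℝ (Fin n) := N₁.piecewise g f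
  have hk₁ : (N₁ ∩ V).EqOn k g := fun p hp ↦ Set.piecewise_eq_of_mem _ _ _ hp.1
  have hk₂ : (N₂ ∩ U).EqOn k f := fun p hp ↦
    Set.piecewise_eq_of_notMem _ _ _ fun h ↦ (Set.disjoint_left.1 hdisj) h hp.1
  have hO₁ : IsOpen (N₁ ∩ V) := hN₁.inter hV
  have hO₂ : IsOpen (N₂ ∩ U) := hN₂.inter hU
  have hkc : IsConformalHarmonicImmersionOn k (N₁ ∩ V ∪ N₂ ∩ U) :=
    ((hg.mono Set.inter_subset_right).congr hO₁ hk₁).union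
      ((hf.mono Set.inter_subset_right).congr hO₂ hk₂)
  have hkΩ : Set.MapsTo k (N₁ ∩ V ∪ N₂ ∩ U) Ω := by
    rintro p (hp | hp)
    · rw [hk₁ hp]; exact hgΩ hp.2
    · rw [hk₂ hp]; exact hfΩ hp.2
  have hFU : F ⊆ U := fun p hp ↦ hAU hp.1.2
  -- Flexibility allows a single order of contact, so the maximum over the finitely many points is
  -- used.
  obtain ⟨B, hB⟩ : BddAbove (m '' {a : A | (a : M) ∈ L}) := by
    refine ((hfin.preimage (f := ((↑) : A → M)) Subtype.val_injective.injOn).subset ?_).image m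
      |>.bddAbove
    exact fun a ha ↦ ⟨ha, a.2⟩
  obtain ⟨g', hg'Ω, hg', hagree, hclose⟩ := hΩ.2.2 M (K ∪ F) (hK.union_finite hF) (L ∩ A) hfin
    (fun p hp ↦ by
      by_cases h : p ∈ K
      · exact Or.inl h
      · exact Or.inr ⟨hp, h⟩)
    (N₁ ∩ V ∪ N₂ ∩ U) (hO₁.union hO₂)
    (Set.union_subset_union (Set.subset_inter hKN hKV) (Set.subset_inter hFN hFU))
    k hkΩ hkc δ hδ B
  refine ⟨g', hg'Ω, hg', fun a ha ↦ ?_, fun p hp ↦ ?_⟩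
  · have h1 := (hagree a ⟨ha, a.2⟩).mono (hB ⟨a, ha, rfl⟩)
    by_cases haK : (a : M) ∈ K
    · refine (h1.trans (.of_eventuallyEq ?_ _)).trans (hgf a haK)
      exact hk₁.eventuallyEq_of_mem (hO₁.mem_nhds ⟨hKN haK, hKV haK⟩)
    · refine h1.trans (.of_eventuallyEq ?_ _)
      exact hk₂.eventuallyEq_of_mem (hO₂.mem_nhds ⟨hFN ⟨⟨ha, a.2⟩, haK⟩, hAU a.2⟩)
  · have := hclose p (Or.inl hp)
    rwa [hk₁ ⟨hKN hp, hKV hp⟩] at this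

/-- In a flexible domain, conformal harmonic immersions can be approximated on compact Runge sets
with jet interpolation on closed discrete sets. -/
theorem IsFlexibleDomain.exists_approx_interpolating {n : ℕ} (Ω : Set (EuclideanSpace ℝ (Fin n)))
    (hΩ : IsFlexibleDomain.{u} Ω)
    (M : Type u) [TopologicalSpace M] [T2Space M] [SecondCountableTopology M]
    [ConnectedSpace M] [NoncompactSpace M] [ChartedSpace ℂ M]
    [IsManifold 𝓘(ℝ, ℂ) ∞ M] [HasGroupoid M (conformalGroupoid (X := ℂ))]
    (U : Set M) (hU : IsOpen U)
    (K : Set M) (hK : IsCompactRunge K) (hKU : K ⊆ U)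
    (A : Set M) (hAclosed : IsClosed A) (hAdiscrete : IsDiscrete A) (hAU : A ⊆ U)
    (f : M → EuclideanSpace ℝ (Fin n)) (hfΩ : Set.MapsTo f U Ω)
    (hf : IsConformalHarmonicImmersionOn f U)
    (ε : ℝ) (hε : 0 < ε) (m : A → ℕ) :
    ∃ g : M → EuclideanSpace ℝ (Fin n),
      (∀ p, g p ∈ Ω) ∧ IsConformalHarmonicImmersionOn g Set.univ ∧
      (∀ a : A, AgreeToOrder (m a) g f a) ∧ ∀ p ∈ K, ‖f p - g p‖ < ε := by
  have := ChartedSpace.locallyCompactSpace ℂ M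
  have := ChartedSpace.locallyConnectedSpace ℂ M
  obtain ⟨E, hE0, hER, hEint, hEcov⟩ := exists_runge_exhaustion hK
  have hEmono : Monotone E := monotone_nat_of_le_succ fun i ↦ (hEint i).trans interior_subset
  -- compact subsets of the interiors of the exhausting sets
  obtain ⟨L, hLc, hLE, hLs⟩ : ∃ L : ℕ → Set M, (∀ i, IsCompact (L i)) ∧
      (∀ i, L i ⊆ interior (E i)) ∧ ∀ i, L (i + 1) = E i := by
    -- The exhaustion shifted by one: the differential is controlled only on a compact subset of the
    -- interior, and at stage `0` nothing is required.
    refine ⟨fun i ↦ Nat.casesOn i ∅ E, fun i ↦ ?_, fun i ↦ ?_, fun i ↦ rfl⟩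
    · cases i with
      | zero => exact isCompact_empty
      | succ i => exact (hER i).1
    · cases i with
      | zero => exact Set.empty_subset _
      | succ i => exact hEint i
  -- The open set `V` is needed for the initial map, which is controlled only on `U`; later stages
  -- take `V` to be all of `M`.
  let Good (i : ℕ) (g : M → EuclideanSpace ℝ (Fin n)) : Prop :=
    ∃ V, IsOpen V ∧ E i ⊆ V ∧ Set.MapsTo g V Ω ∧ IsConformalHarmonicImmersionOn g V ∧
      ∀ a : A, (a : M) ∈ E i → AgreeToOrder (m a) g f a
  -- The bound `2 * δ` is the total of the later errors, so this applies to the limit map.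
  let Stable (i : ℕ) (g : M → EuclideanSpace ℝ (Fin n)) (δ : ℝ) : Prop :=
    ∀ h : M → EuclideanSpace ℝ (Fin n), (∀ p ∈ E i, ‖h p - g p‖ ≤ 2 * δ) →
      Set.MapsTo h (E i) Ω ∧ (IsHarmonicOn h (interior (E i)) →
        ∀ y ∈ L i, ∃ φ ∈ atlas ℂ M, y ∈ φ.source ∧ fderiv ℝ (h ∘ φ.symm) (φ y) ≠ 0)
  have hstable : ∀ i g, Good i g → ∀ η > 0, ∃ δ, 0 < δ ∧ δ ≤ η ∧ Stable i g δ := by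
    rintro i g ⟨V, -, hEV, hgΩ, hg, -⟩ η hη
    have hgE := hg.mono hEV
    obtain ⟨δ₁, hδ₁, h₁⟩ := exists_pos_mapsTo (hER i).1 hgE.isHarmonicOn.continuousOn hΩ.1
      (hgΩ.mono_left hEV)
    obtain ⟨δ₂, hδ₂, h₂⟩ := exists_pos_fderiv_ne_zero hgE (hLc i) (hLE i)
    have hle₁ : min η (min (δ₁ / 2) (δ₂ / 2)) ≤ δ₁ / 2 := (min_le_right _ _).trans (min_le_left _ _)
    have hle₂ : min η (min (δ₁ / 2) (δ₂ / 2)) ≤ δ₂ / 2 := (min_le_right _ _).trans (min_le_right _ _)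
    refine ⟨min η (min (δ₁ / 2) (δ₂ / 2)), by positivity, min_le_left _ _, fun h hh ↦ ⟨?_, ?_⟩⟩
    · exact h₁ h fun p hp ↦ (hh p hp).trans (by linarith)
    · exact fun hharm ↦ h₂ h hharm fun p hp ↦ (hh p hp).trans (by linarith)
  let State (i : ℕ) := {x : (M → EuclideanSpace ℝ (Fin n)) × ℝ //
    Good i x.1 ∧ 0 < x.2 ∧ Stable i x.1 x.2}
  have hstep : ∀ i (x : State i), ∃ y : State (i + 1), y.1.2 ≤ x.1.2 / 2 ∧
      ∀ p ∈ E i, ‖y.1.1 p - x.1.1 p‖ ≤ x.1.2 := by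
    rintro i ⟨⟨g, δ⟩, ⟨V, hV, hEV, hgΩ, hg, hgf⟩, hδ, -⟩
    obtain ⟨g', hg'Ω, hg', hg'f, hclose⟩ := hΩ.exists_approx hU hfΩ hf hAU hAclosed hAdiscrete m
      (hER i) (hER (i + 1)).1 hV hEV hgΩ hg hgf hδ
    have hgood : Good (i + 1) g' :=
      ⟨Set.univ, isOpen_univ, Set.subset_univ _, fun p _ ↦ hg'Ω p, hg', hg'f⟩
    obtain ⟨δ', hδ', hle, hst⟩ := hstable (i + 1) g' hgood (δ / 2) (half_pos hδ)
    exact ⟨⟨(g', δ'), hgood, hδ', hst⟩, hle, fun p hp ↦ (hclose p hp).le⟩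
  choose next hnext hnext' using hstep
  have hgood₀ : Good 0 f :=
    ⟨U, hU, hE0 ▸ hKU, hfΩ, hf, fun a _ ↦ .of_eventuallyEq .rfl _⟩
  -- The total error on `K` is then at most `2 * δ₀ ≤ ε / 2 < ε`.
  obtain ⟨δ₀, hδ₀, hδ₀ε, hst₀⟩ := hstable 0 f hgood₀ (ε / 4) (by positivity)
  let X : ∀ i, State i := fun i ↦ Nat.rec ⟨(f, δ₀), hgood₀, hδ₀, hst₀⟩ next i
  obtain ⟨g, hgX, hglim⟩ := exists_limit_of_exhaustion hEmono hEcov (g := fun i ↦ (X i).1.1)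
    (δ := fun i ↦ (X i).1.2) (fun i ↦ (X i).2.2.1) (fun i ↦ hnext i (X i))
    (fun i ↦ hnext' i (X i))
  have hconf : ∀ i, ∀ k ≥ i, IsConformalHarmonicImmersionOn (X k).1.1 (interior (E i)) := by
    intro i k hk
    obtain ⟨V, -, hEV, -, hX, -⟩ := (X k).2.1
    exact hX.mono (interior_subset.trans ((hEmono hk).trans hEV))
  have hconf' : ∀ i, ∀ᶠ k in atTop,
      IsConformalHarmonicImmersionOn (X k).1.1 (interior (E i)) := fun i ↦
    (eventually_ge_atTop i).mono (hconf i)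
  have hharm' : ∀ i, ∀ᶠ k in atTop, IsHarmonicOn (X k).1.1 (interior (E i)) := fun i ↦
    (hconf' i).mono fun k hk ↦ hk.isHarmonicOn
  have hlim : ∀ i, TendstoUniformlyOn (fun k ↦ (X k).1.1) g atTop (interior (E i)) := fun i ↦
    (hglim i).mono interior_subset
  have hharm : ∀ i, IsHarmonicOn g (interior (E i)) := fun i ↦
    isHarmonicOn_of_tendstoUniformlyOn isOpen_interior (hharm' i) (hlim i)
  refine ⟨g, fun p ↦ ?_, fun φ hφ x hx ↦ ?_, fun a ↦ ?_, fun p hp ↦ ?_⟩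
  · obtain ⟨i, hi⟩ := hEcov p
    exact ((X i).2.2.2 g (hgX i)).1 hi
  · obtain ⟨i, hi⟩ := hEcov x
    -- Stage `i + 1` is used because its stability controls the differential on `L (i + 1) = E i`.
    refine isConformalHarmonicImmersionOn_of_tendstoUniformlyOn isOpen_interior (hEint i)
      (hconf' (i + 1)) (hlim (i + 1)) (fun y hy ↦ ?_) φ hφ x ⟨hi, hx.2⟩
    exact ((X (i + 1)).2.2.2 g (hgX (i + 1))).2 (hharm (i + 1)) y ((hLs i).symm ▸ hy)
  · obtain ⟨i, hi⟩ := hEcov a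
    refine agreeToOrder_of_tendstoUniformlyOn isOpen_interior (hEint i hi) (hharm' (i + 1))
      (hlim (i + 1)) ?_
    filter_upwards [eventually_ge_atTop i] with k hk
    obtain ⟨V, -, -, -, -, hagree⟩ := (X k).2.1
    exact hagree a (hEmono hk hi)
  · have h0 : ‖g p - f p‖ ≤ 2 * δ₀ := hgX 0 p (hE0.symm ▸ hp)
    rw [norm_sub_rev]
    linarith

end MinimalSurface

theorem proposition1p2 {n : ℕ} (hn : 3 ≤ n) (Ω : Set (EuclideanSpace ℝ (Fin n)))
    (hΩ : MinimalSurface.IsFlexibleDomain.{u} Ω)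
    (M : Type u) [TopologicalSpace M] [T2Space M] [SecondCountableTopology M]
    [ConnectedSpace M] [NoncompactSpace M] [ChartedSpace ℂ M]
    [IsManifold 𝓘(ℝ, ℂ) ∞ M] [HasGroupoid M (conformalGroupoid (X := ℂ))]
    (U : Set M) (hU : IsOpen U)
    (K : Set M) (hK : MinimalSurface.IsCompactRunge K) (hKU : K ⊆ U)
    (A : Set M) (hAclosed : IsClosed A) (hAdiscrete : IsDiscrete A) (hAU : A ⊆ U)
    (f : M → EuclideanSpace ℝ (Fin n)) (hfΩ : Set.MapsTo f U Ω)
    (hf : MinimalSurface.IsConformalHarmonicImmersionOn f U)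
    (ε : ℝ) (hε : 0 < ε) (m : A → ℕ) :
    ∃ g : M → EuclideanSpace ℝ (Fin n),
      (∀ p, g p ∈ Ω) ∧ MinimalSurface.IsConformalHarmonicImmersionOn g Set.univ ∧
      (∀ a : A, MinimalSurface.AgreeToOrder (m a) g f a) ∧ ∀ p ∈ K, ‖f p - g p‖ < ε :=
  MinimalSurface.IsFlexibleDomain.exists_approx_interpolating Ω hΩ M U hU K hK hKU A hAclosed
    hAdiscrete hAU f hfΩ hf ε hε m
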